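/- A spherical curve is a closed, immersed, locally convex $C^\infty$ curve $\gamma:\mathbb R/\mathbb Z\to S^2\subset\mathbb R^3$; locally convex means that its geodesic curvature $\kappa=\langle\gamma_{tt},\gamma\times\gamma_t\rangle$ vanishes nowhere, where $t$ is the arc length of $\gamma$. Its dual is the spherical curve $\overline\gamma=\gamma\times\gamma_t$, with arc length $s$. Let $\mathcal C_\gamma$ be the real vector space of $C^\infty$ functions $\rho$ on the closed curve $\gamma$ with $\int\rho\,\gamma\,dt=0$; equivalently, the space of closed space curves $\Gamma$ with $d\Gamma=\rho\,\gamma\,dt$, up to parallel translation. Let the evolute map be the linear map $$\mathcal E:\mathcal C_\gamma\to\mathcal C_{\overline\gamma},\qquad \mathcal E(\rho)=\rho+\rho_{ss}.$$ Proposition. For a generic spherical curve $\gamma$, the map $\mathcal E:\mathcal C_\gamma\to\mathcal C_{\overline\gamma}$ is a linear bijection. Precisely, it is a bijection whenever the total geodesic curvature $\int\kappa\,dt$ of $\gamma$ is not an integer multiple of $2\pi$, and the spherical curves with this property form an open dense subset of the space of all spherical curves with the $C^\infty$ topology. -/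

import Mathlib

open scoped ContDiff

namespace SpatialEvolute

/-- Euclidean three-space. -/
abbrev E3 : Type := EuclideanSpace ℝ (Fin 3)

/-- The cross product of two vectors of Euclidean three-space. -/
def cross (v w : E3) : E3 := WithLp.toLp 2 (crossProduct v.ofLp w.ofLp)

/-- The derivative of `f` with respect to the arc length of the parametrized curve `c`,
where `f` is a function of the parameter of `c`. -/
noncomputable def arcDeriv {F : Type*} [NormedAddCommGroup F] [NormedSpace ℝ F]
    (c : ℝ → E3) (f : ℝ → F) (u : ℝ) : F :=
  ‖deriv c u‖⁻¹ • deriv f u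

/-- The dual curve `c × c_t` of a curve `c` on the unit sphere (`t` is the arc length of `c`):
each point is moved by `π / 2` along the great circle in the direction of the unit normal. -/
noncomputable def dualFun (c : ℝ → E3) (u : ℝ) : E3 :=
  cross (c u) (arcDeriv c c u)

/-- The geodesic curvature `⟨c_tt, c × c_t⟩` of a curve `c` on the unit sphere
(`t` is the arc length of `c`). -/
noncomputable def geodesicCurvature (c : ℝ → E3) (u : ℝ) : ℝ :=
  inner ℝ (arcDeriv c (arcDeriv c c) u) (dualFun c u)

/-- A spherical curve: a closed immersed locally convex smooth curve on the unit sphere,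
with a regular parameter running through `ℝ / ℤ`. -/
structure SphericalCurve where
  toFun : ℝ → E3
  smooth : ContDiff ℝ ∞ toFun
  closed : Function.Periodic toFun 1
  norm_eq_one : ∀ u, ‖toFun u‖ = 1
  immersed : ∀ u, deriv toFun u ≠ 0
  locallyConvex : ∀ u, geodesicCurvature toFun u ≠ 0

/-- The `C^∞` topology on spherical curves: uniform convergence of the curves
together with their derivatives of every order. -/
noncomputable instance : TopologicalSpace SphericalCurve :=
  ⨅ k : ℕ, TopologicalSpace.induced
    (fun γ => UniformFun.ofFun (iteratedDeriv k γ.toFun)) inferInstance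

section Helpers

theorem contDiff_cross {f g : ℝ → E3} (hf : ContDiff ℝ ∞ f) (hg : ContDiff ℝ ∞ g) :
    ContDiff ℝ ∞ (fun u => cross (f u) (g u)) := by
  have hf' := contDiff_euclidean.1 hf
  have hg' := contDiff_euclidean.1 hg
  rw [contDiff_euclidean]
  intro i
  fin_cases i <;> simp only [cross, cross_apply] <;> simp <;>
    exact ((hf' _).mul (hg' _)).sub ((hf' _).mul (hg' _))

theorem inner_eq (v w : E3) : inner ℝ v w = v 0 * w 0 + v 1 * w 1 + v 2 * w 2 := by
  simp [PiLp.inner_apply, Fin.sum_univ_three]; ring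

theorem cross_zero' (v w : E3) : cross v w 0 = v 1 * w 2 - v 2 * w 1 := by
  simp [cross, cross_apply]

theorem cross_one' (v w : E3) : cross v w 1 = v 2 * w 0 - v 0 * w 2 := by
  simp [cross, cross_apply]

theorem cross_two' (v w : E3) : cross v w 2 = v 0 * w 1 - v 1 * w 0 := by
  simp [cross, cross_apply]

theorem ext3 {v w : E3} (h0 : v 0 = w 0) (h1 : v 1 = w 1) (h2 : v 2 = w 2) : v = w := by
  ext i; fin_cases i <;> assumption

theorem inner_cross_left (v w : E3) : inner ℝ v (cross v w) = 0 := by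
  rw [inner_eq, cross_zero', cross_one', cross_two']; ring

theorem inner_cross_right (v w : E3) : inner ℝ w (cross v w) = 0 := by
  rw [inner_eq, cross_zero', cross_one', cross_two']; ring

theorem cross_smul (a : ℝ) (v w : E3) : cross v (a • w) = a • cross v w := by
  simp [cross]

theorem cross_add (v w x : E3) : cross v (w + x) = cross v w + cross v x := by
  simp [cross]

theorem smul_cross (a : ℝ) (v w : E3) : cross (a • v) w = a • cross v w := by
  simp [cross]

theorem cross_self' (v : E3) : cross v v = 0 := by
  simp [cross]

theorem hasDerivAt_E3 {f : ℝ → E3} {f' : E3} {u : ℝ} :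
    HasDerivAt f f' u ↔ ∀ i, HasDerivAt (fun x => f x i) (f' i) u := by
  rw [hasDerivAt_iff_hasFDerivAt, ← hasFDerivWithinAt_univ, hasFDerivWithinAt_euclidean]
  apply forall_congr'
  intro i
  rw [hasFDerivWithinAt_univ, hasDerivAt_iff_hasFDerivAt]
  have h : (PiLp.proj 2 (fun _ : Fin 3 => ℝ) i ∘L ContinuousLinearMap.toSpanSingleton ℝ f') =
      ContinuousLinearMap.toSpanSingleton ℝ (f' i) := by
    ext; simp
  rw [← h]

theorem hasDerivAt_cross {f g : ℝ → E3} {f' g' : E3} {u : ℝ} (hf : HasDerivAt f f' u)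
    (hg : HasDerivAt g g' u) :
    HasDerivAt (fun u => cross (f u) (g u)) (cross f' (g u) + cross (f u) g') u := by
  rw [hasDerivAt_E3] at *
  intro i
  fin_cases i <;> simp only [cross, cross_apply] <;> simp
  · refine (((hf 1).mul (hg 2)).sub ((hf 2).mul (hg 1))).congr_deriv ?_; simp; ring
  · refine (((hf 2).mul (hg 0)).sub ((hf 0).mul (hg 2))).congr_deriv ?_; simp; ring
  · refine (((hf 0).mul (hg 1)).sub ((hf 1).mul (hg 0))).congr_deriv ?_; simp; ring

theorem inner_cross_cross {T N : E3} (hT : inner ℝ T T = 1) (hN : inner ℝ N N = 1)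
    (hTN : inner ℝ T N = 0) : inner ℝ (cross T N) (cross T N) = 1 := by
  rw [inner_eq] at *
  rw [cross_zero', cross_one', cross_two']
  linear_combination (N 0 * N 0 + N 1 * N 1 + N 2 * N 2) * hT + hN
    - (T 0 * N 0 + T 1 * N 1 + T 2 * N 2) * hTN

theorem cross_cross_left {T N : E3} (hT : inner ℝ T T = 1) (hTN : inner ℝ T N = 0) :
    cross T (cross T N) = -N := by
  rw [inner_eq] at *
  apply ext3 <;> simp only [cross_zero', cross_one', cross_two', PiLp.neg_apply]
  · linear_combination T 0 * hTN - N 0 * hT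
  · linear_combination T 1 * hTN - N 1 * hT
  · linear_combination T 2 * hTN - N 2 * hT

theorem cross_cross_right {T N : E3} (hN : inner ℝ N N = 1) (hTN : inner ℝ T N = 0) :
    cross (cross T N) N = -T := by
  rw [inner_eq] at *
  apply ext3 <;> simp only [cross_zero', cross_one', cross_two', PiLp.neg_apply]
  · linear_combination N 0 * hTN - T 0 * hN
  · linear_combination N 1 * hTN - T 1 * hN
  · linear_combination N 2 * hTN - T 2 * hN

theorem frame_expand {T N : E3} (hT : inner ℝ T T = 1) (hN : inner ℝ N N = 1)
    (hTN : inner ℝ T N = 0) (x : E3) :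
    x = inner ℝ T x • T + inner ℝ N x • N + inner ℝ (cross T N) x • cross T N := by
  have hB := inner_cross_cross hT hN hTN
  have hNT : inner ℝ N T = 0 := by rw [real_inner_comm]; exact hTN
  have ho : Orthonormal ℝ ![T, N, cross T N] := by
    rw [orthonormal_iff_ite]
    intro i j
    have h1 := inner_cross_left T N
    have h2 := inner_cross_right T N
    have h3 := (real_inner_comm (cross T N) T).symm.trans h1
    have h4 := (real_inner_comm (cross T N) N).symm.trans h2
    fin_cases i <;> fin_cases j <;> simp_all
  have hspan : ⊤ ≤ Submodule.span ℝ (Set.range ![T, N, cross T N]) := by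
    rw [ho.linearIndependent.span_eq_top_of_card_eq_finrank (by simp)]
  have := ((OrthonormalBasis.mk ho hspan).sum_repr' x).symm
  simpa [Fin.sum_univ_three] using this

theorem contDiff_deriv {F : Type*} [NormedAddCommGroup F] [NormedSpace ℝ F] {f : ℝ → F}
    (hf : ContDiff ℝ ∞ f) : ContDiff ℝ ∞ (deriv f) :=
  (contDiff_infty_iff_deriv.1 hf).2

theorem contDiff_arcDeriv {F : Type*} [NormedAddCommGroup F] [NormedSpace ℝ F]
    {c : ℝ → E3} {f : ℝ → F} (hc : ContDiff ℝ ∞ c) (h0 : ∀ u, deriv c u ≠ 0)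
    (hf : ContDiff ℝ ∞ f) : ContDiff ℝ ∞ (arcDeriv c f) :=
  (((contDiff_deriv hc).norm ℝ h0).inv fun u => norm_ne_zero_iff.2 (h0 u)).smul
    (contDiff_deriv hf)

theorem periodic_deriv {F : Type*} [NormedAddCommGroup F] [NormedSpace ℝ F] {f : ℝ → F}
    (hf : Function.Periodic f 1) : Function.Periodic (deriv f) 1 := by
  intro u
  rw [← deriv_comp_add_const]
  congr 1
  exact funext hf

theorem periodic_arcDeriv {F : Type*} [NormedAddCommGroup F] [NormedSpace ℝ F]
    {c : ℝ → E3} {f : ℝ → F} (hc : Function.Periodic c 1) (hf : Function.Periodic f 1) :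
    Function.Periodic (arcDeriv c f) 1 := by
  intro u
  simp only [arcDeriv, periodic_deriv hc u, periodic_deriv hf u]

variable (γ : SphericalCurve) (u : ℝ)

theorem speed_pos : 0 < ‖deriv γ.toFun u‖ := norm_pos_iff.2 (γ.immersed u)

theorem inner_self_one : inner ℝ (γ.toFun u) (γ.toFun u) = (1 : ℝ) := by
  rw [real_inner_self_eq_norm_sq, γ.norm_eq_one]; norm_num

theorem contDiff_tangent : ContDiff ℝ ∞ (arcDeriv γ.toFun γ.toFun) :=
  contDiff_arcDeriv γ.smooth γ.immersed γ.smooth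

theorem contDiff_dualFun : ContDiff ℝ ∞ (dualFun γ.toFun) :=
  contDiff_cross γ.smooth (contDiff_tangent γ)

theorem hasDerivAt_of_smooth {F : Type*} [NormedAddCommGroup F] [NormedSpace ℝ F] {f : ℝ → F}
    (hf : ContDiff ℝ ∞ f) (u : ℝ) : HasDerivAt f (deriv f u) u :=
  (hf.differentiable (by simp) u).hasDerivAt

theorem deriv_eq_speed_smul {F : Type*} [NormedAddCommGroup F] [NormedSpace ℝ F] (f : ℝ → F) :
    deriv f u = ‖deriv γ.toFun u‖ • arcDeriv γ.toFun f u := by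
  rw [arcDeriv, smul_smul, mul_inv_cancel₀ (speed_pos γ u).ne', one_smul]

theorem inner_tangent_self :
    inner ℝ (arcDeriv γ.toFun γ.toFun u) (arcDeriv γ.toFun γ.toFun u) = (1 : ℝ) := by
  rw [real_inner_self_eq_norm_sq, arcDeriv, norm_smul, norm_inv, norm_norm,
    inv_mul_cancel₀ (speed_pos γ u).ne']
  norm_num

theorem inner_deriv_of_const {f g : ℝ → E3} (hf : ContDiff ℝ ∞ f) (hg : ContDiff ℝ ∞ g) {a : ℝ}
    (h : ∀ u, inner ℝ (f u) (g u) = a) (u : ℝ) :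
    inner ℝ (f u) (deriv g u) + inner ℝ (deriv f u) (g u) = 0 := by
  have h1 := (hasDerivAt_of_smooth hf u).inner ℝ (hasDerivAt_of_smooth hg u)
  have h2 : (fun t => inner ℝ (f t) (g t)) = fun _ => a := funext h
  rw [h2] at h1
  exact h1.unique (hasDerivAt_const u a)

theorem inner_tangent : inner ℝ (γ.toFun u) (arcDeriv γ.toFun γ.toFun u) = (0 : ℝ) := by
  have h := inner_deriv_of_const γ.smooth γ.smooth (inner_self_one γ) u
  rw [real_inner_comm (γ.toFun u) (deriv γ.toFun u)] at h
  rw [arcDeriv, inner_smul_right]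
  have : inner ℝ (γ.toFun u) (deriv γ.toFun u) = (0 : ℝ) := by
    linarith
  rw [this, mul_zero]

/-- `N_t = -T + κ B`. -/
theorem arcDeriv_tangent : arcDeriv γ.toFun (arcDeriv γ.toFun γ.toFun) u =
    -γ.toFun u + geodesicCurvature γ.toFun u • dualFun γ.toFun u := by
  have e := frame_expand (inner_self_one γ u) (inner_tangent_self γ u) (inner_tangent γ u)
    (arcDeriv γ.toFun (arcDeriv γ.toFun γ.toFun) u)
  have h1 := inner_deriv_of_const γ.smooth (contDiff_tangent γ) (inner_tangent γ) u
  have h2 := inner_deriv_of_const (contDiff_tangent γ) (contDiff_tangent γ)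
    (inner_tangent_self γ) u
  have i1 : inner ℝ (deriv γ.toFun u) (arcDeriv γ.toFun γ.toFun u) = ‖deriv γ.toFun u‖ := by
    conv_lhs => rw [deriv_eq_speed_smul γ u γ.toFun, inner_smul_left, inner_tangent_self]
    simp
  rw [deriv_eq_speed_smul γ u, inner_smul_right, i1] at h1
  rw [deriv_eq_speed_smul γ u, inner_smul_right, inner_smul_left,
    real_inner_comm (arcDeriv γ.toFun γ.toFun u)] at h2
  simp only [conj_trivial] at h2
  have hv := speed_pos γ u
  have g1 : inner ℝ (γ.toFun u) (arcDeriv γ.toFun (arcDeriv γ.toFun γ.toFun) u) = (-1 : ℝ) :=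
    mul_left_cancel₀ hv.ne' (by linarith)
  have g2 : inner ℝ (arcDeriv γ.toFun γ.toFun u)
      (arcDeriv γ.toFun (arcDeriv γ.toFun γ.toFun) u) = (0 : ℝ) :=
    mul_left_cancel₀ hv.ne' (by linarith)
  rw [g1, g2] at e
  rw [geodesicCurvature, real_inner_comm]
  simpa [dualFun] using e

theorem hasDerivAt_tangent : HasDerivAt (arcDeriv γ.toFun γ.toFun)
    (‖deriv γ.toFun u‖ • (-γ.toFun u + geodesicCurvature γ.toFun u • dualFun γ.toFun u)) u := by
  rw [← arcDeriv_tangent, ← deriv_eq_speed_smul]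
  exact hasDerivAt_of_smooth (contDiff_tangent γ) u

/-- `B_t = -κ N`. -/
theorem hasDerivAt_dualFun : HasDerivAt (dualFun γ.toFun)
    (-(‖deriv γ.toFun u‖ * geodesicCurvature γ.toFun u) • arcDeriv γ.toFun γ.toFun u) u := by
  have h := hasDerivAt_cross (hasDerivAt_of_smooth γ.smooth u) (hasDerivAt_tangent γ u)
  refine h.congr_deriv ?_
  have e : cross (deriv γ.toFun u) (arcDeriv γ.toFun γ.toFun u) = 0 := by
    conv_lhs => rw [deriv_eq_speed_smul γ u γ.toFun, smul_cross, cross_self', smul_zero]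
  rw [e, cross_smul, cross_add, cross_smul,
    ← neg_one_smul ℝ (γ.toFun u), cross_smul, cross_self', dualFun,
    cross_cross_left (inner_self_one γ u) (inner_tangent γ u)]
  simp [smul_smul]

theorem deriv_dualFun : deriv (dualFun γ.toFun) u =
    -(‖deriv γ.toFun u‖ * geodesicCurvature γ.toFun u) • arcDeriv γ.toFun γ.toFun u :=
  (hasDerivAt_dualFun γ u).deriv

theorem norm_tangent : ‖arcDeriv γ.toFun γ.toFun u‖ = 1 := by
  have := inner_tangent_self γ u
  rw [real_inner_self_eq_norm_sq] at this
  exact (pow_eq_one_iff_of_nonneg (norm_nonneg _) two_ne_zero).1 this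

theorem norm_deriv_dualFun : ‖deriv (dualFun γ.toFun) u‖ =
    ‖deriv γ.toFun u‖ * |geodesicCurvature γ.toFun u| := by
  rw [deriv_dualFun, norm_smul, norm_tangent, mul_one, norm_neg, norm_mul, norm_norm,
    Real.norm_eq_abs]

/-- The geodesic curvature has a constant sign. -/
theorem exists_sign : ∃ ε : ℝ, ε * ε = 1 ∧ ∀ u, geodesicCurvature γ.toFun u =
    ε * |geodesicCurvature γ.toFun u| := by
  have hc : Continuous (geodesicCurvature γ.toFun) :=
    ((contDiff_arcDeriv γ.smooth γ.immersed (contDiff_tangent γ)).inner ℝ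
      (contDiff_dualFun γ)).continuous
  by_cases hp : ∀ u, 0 < geodesicCurvature γ.toFun u
  · exact ⟨1, by norm_num, fun u => by rw [abs_of_pos (hp u), one_mul]⟩
  · refine ⟨-1, by norm_num, fun u => ?_⟩
    push Not at hp
    obtain ⟨a, ha⟩ := hp
    have : geodesicCurvature γ.toFun u ≤ 0 := by
      by_contra! hu
      obtain ⟨z, hz⟩ := mem_range_of_exists_le_of_exists_ge hc ⟨a, ha⟩ ⟨u, hu.le⟩
      exact γ.locallyConvex z hz
    rw [abs_of_nonpos this]; ring

theorem arcDeriv_dualFun {ε : ℝ} (h : ∀ u, geodesicCurvature γ.toFun u =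
    ε * |geodesicCurvature γ.toFun u|) :
    arcDeriv (dualFun γ.toFun) (dualFun γ.toFun) = fun u => -ε • arcDeriv γ.toFun γ.toFun u := by
  funext u
  have hv := (speed_pos γ u).ne'
  have hk := abs_ne_zero.2 (γ.locallyConvex u)
  rw [arcDeriv, norm_deriv_dualFun, deriv_dualFun, smul_smul, h u]
  congr 1
  rw [abs_mul, abs_abs]
  have : |ε| * |geodesicCurvature γ.toFun u| = |geodesicCurvature γ.toFun u| := by
    rw [← abs_abs (geodesicCurvature γ.toFun u), ← abs_mul, ← h u, abs_abs]
  rw [this]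
  field_simp

/-- The derivative of `B_s` with respect to the parameter. -/
theorem hasDerivAt_arcDeriv_dualFun {ε : ℝ} (h : ∀ u, geodesicCurvature γ.toFun u =
    ε * |geodesicCurvature γ.toFun u|) : HasDerivAt (arcDeriv (dualFun γ.toFun) (dualFun γ.toFun))
    (-ε • (‖deriv γ.toFun u‖ •
      (-γ.toFun u + geodesicCurvature γ.toFun u • dualFun γ.toFun u))) u := by
  rw [arcDeriv_dualFun γ h]
  exact (hasDerivAt_tangent γ u).const_smul (-ε)

theorem geodesicCurvature_dualFun :
    geodesicCurvature (dualFun γ.toFun) u = |geodesicCurvature γ.toFun u|⁻¹ := by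
  obtain ⟨ε, hε, h⟩ := exists_sign γ
  have hv := (speed_pos γ u).ne'
  have hk := abs_ne_zero.2 (γ.locallyConvex u)
  have hB : dualFun (dualFun γ.toFun) u = ε • γ.toFun u := by
    rw [dualFun, arcDeriv_dualFun γ h, cross_smul, dualFun,
      cross_cross_right (inner_tangent_self γ u) (inner_tangent γ u)]
    simp
  rw [geodesicCurvature, hB, arcDeriv, (hasDerivAt_arcDeriv_dualFun γ u h).deriv,
    norm_deriv_dualFun]
  have h0 : inner ℝ (dualFun γ.toFun u) (γ.toFun u) = (0 : ℝ) := by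
    rw [real_inner_comm]; exact inner_cross_left _ _
  simp only [inner_smul_left, inner_smul_right, inner_add_left, inner_neg_left, conj_trivial, h0,
    inner_self_one γ u]
  field_simp
  linear_combination hε

end Helpers

namespace SphericalCurve

/-- The spherical curve dual to `γ`. -/
noncomputable def dual (γ : SphericalCurve) : SphericalCurve where
  toFun := dualFun γ.toFun
  smooth := contDiff_dualFun γ
  closed := fun u => by
    rw [dualFun, γ.closed u, periodic_arcDeriv γ.closed γ.closed u, dualFun]
  norm_eq_one := fun u => by
    have h := inner_cross_cross (inner_self_one γ u) (inner_tangent_self γ u) (inner_tangent γ u)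
    rw [real_inner_self_eq_norm_sq] at h
    exact (pow_eq_one_iff_of_nonneg (norm_nonneg _) two_ne_zero).1 h
  immersed := fun u => by
    rw [← norm_ne_zero_iff, norm_deriv_dualFun]
    exact mul_ne_zero (speed_pos γ u).ne' (abs_ne_zero.2 (γ.locallyConvex u))
  locallyConvex := fun u => by
    rw [geodesicCurvature_dualFun]
    exact inv_ne_zero (abs_ne_zero.2 (γ.locallyConvex u))

/-- The total geodesic curvature `∫ κ dt` of `γ` with respect to its arc length `t`. -/
noncomputable def totalGeodesicCurvature (γ : SphericalCurve) : ℝ :=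
  ∫ u in (0 : ℝ)..1, geodesicCurvature γ.toFun u * ‖deriv γ.toFun u‖

/-- The genericity condition: the total geodesic curvature is not an integer multiple of `2 π`. -/
def Generic (γ : SphericalCurve) : Prop :=
  ∀ n : ℤ, γ.totalGeodesicCurvature ≠ 2 * Real.pi * n

end SphericalCurve

/-- The space `C_γ` of smooth functions `ρ` on the closed curve `γ` with `∫ ρ γ dt = 0`, where `t`
is the arc length of `γ`. Such `ρ` is the same thing as the closed space curve `Γ`, up to
translations, with `dΓ = ρ γ dt`. -/
noncomputable def curveSpace (γ : SphericalCurve) : Submodule ℝ (ℝ → ℝ) where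
  carrier := {ρ | ContDiff ℝ ∞ ρ ∧ Function.Periodic ρ 1 ∧
    ∫ u in (0 : ℝ)..1, (ρ u * ‖deriv γ.toFun u‖) • γ.toFun u = 0}
  add_mem' := by
    rintro ρ₁ ρ₂ ⟨h1, h2, h3⟩ ⟨k1, k2, k3⟩
    have hv := (contDiff_deriv γ.smooth).continuous.norm
    refine ⟨h1.add k1, h2.add k2, ?_⟩
    simp only [Pi.add_apply, add_mul, add_smul]
    rw [intervalIntegral.integral_add, h3, k3, add_zero]
    · exact ((h1.continuous.mul hv).smul γ.smooth.continuous).intervalIntegrable _ _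
    · exact ((k1.continuous.mul hv).smul γ.smooth.continuous).intervalIntegrable _ _
  zero_mem' := ⟨contDiff_const, fun _ => rfl, by simp⟩
  smul_mem' := by
    rintro a ρ ⟨h1, h2, h3⟩
    refine ⟨contDiff_const.mul h1, fun u => by simp [h2 u], ?_⟩
    simp only [Pi.smul_apply, smul_eq_mul, mul_assoc]
    simp only [mul_smul] at h3 ⊢
    rw [intervalIntegral.integral_smul, h3, smul_zero]

/-- The function `ρ + ρ_ss`, where `s` is the arc length of the dual curve. -/
noncomputable def evoluteFun (γ : SphericalCurve) (ρ : ℝ → ℝ) (u : ℝ) : ℝ :=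
  ρ u + arcDeriv γ.dual.toFun (arcDeriv γ.dual.toFun ρ) u

section Helpers

theorem evoluteFun_mem (γ : SphericalCurve) {ρ : ℝ → ℝ} (hρ : ρ ∈ curveSpace γ) :
    evoluteFun γ ρ ∈ curveSpace γ.dual := by
  obtain ⟨h1, h2, h3⟩ := hρ
  have s1 := contDiff_arcDeriv γ.dual.smooth γ.dual.immersed h1
  have s2 := contDiff_arcDeriv γ.dual.smooth γ.dual.immersed s1
  have p1 := periodic_arcDeriv γ.dual.closed h2
  have p2 := periodic_arcDeriv γ.dual.closed p1
  refine ⟨h1.add s2, fun u => by simp only [evoluteFun]; rw [h2 u, p2 u], ?_⟩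
  obtain ⟨ε, hε, h⟩ := exists_sign γ
  -- the primitive `ρ_s B - ρ B_s` of `(ρ + ρ_ss) B - ε ρ T / |κ|`, in terms of `s`
  set F : ℝ → E3 := fun u => arcDeriv γ.dual.toFun ρ u • γ.dual.toFun u -
    ρ u • arcDeriv γ.dual.toFun γ.dual.toFun u with hF
  have hd : ∀ u, HasDerivAt F ((evoluteFun γ ρ u * ‖deriv γ.dual.toFun u‖) • γ.dual.toFun u -
      ε • ((ρ u * ‖deriv γ.toFun u‖) • γ.toFun u)) u := by
    intro u
    have a1 := (hasDerivAt_of_smooth s1 u).smul (hasDerivAt_of_smooth γ.dual.smooth u)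
    have a2 := (hasDerivAt_of_smooth h1 u).smul (hasDerivAt_arcDeriv_dualFun γ u h)
    refine (a1.sub a2).congr_deriv ?_
    have d1 := deriv_eq_speed_smul γ.dual u (arcDeriv γ.dual.toFun ρ)
    have d2 := deriv_eq_speed_smul γ.dual u γ.dual.toFun
    have d3 := deriv_eq_speed_smul γ.dual u ρ
    have hn : ‖deriv γ.dual.toFun u‖ = ‖deriv γ.toFun u‖ * |geodesicCurvature γ.toFun u| :=
      norm_deriv_dualFun γ u
    have hk := h u
    have e0 : ε * geodesicCurvature γ.toFun u = |geodesicCurvature γ.toFun u| := by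
      rw [hk, ← mul_assoc, hε, one_mul, ← hk]
    obtain ⟨w, hw⟩ : ∃ w, w = ‖deriv γ.dual.toFun u‖ := ⟨_, rfl⟩
    rw [← hw] at d1 d2 d3 hn ⊢
    rw [d1, d2, d3, hn, ← e0]
    simp only [evoluteFun, smul_eq_mul]
    change _ • _ + _ • γ.dual.toFun u - (_ • (-ε • (_ • (-γ.toFun u + _ • γ.dual.toFun u))) +
      _ • arcDeriv γ.dual.toFun γ.dual.toFun u) = _
    module
  have hper : F 1 = F 0 := by
    have e1 := p1 0
    have e2 := h2 0
    have e3 := γ.dual.closed 0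
    have e4 := periodic_arcDeriv γ.dual.closed γ.dual.closed 0
    rw [zero_add] at e1 e2 e3 e4
    simp only [hF, e1, e2, e3, e4]
  have hv := (contDiff_deriv γ.smooth).continuous.norm
  have hw := (contDiff_deriv γ.dual.smooth).continuous.norm
  have c1 : IntervalIntegrable (fun u => (evoluteFun γ ρ u * ‖deriv γ.dual.toFun u‖) •
      γ.dual.toFun u) MeasureTheory.volume 0 1 :=
    (((h1.add s2).continuous.mul hw).smul γ.dual.smooth.continuous).intervalIntegrable _ _
  have c2 : IntervalIntegrable (fun u => ε • ((ρ u * ‖deriv γ.toFun u‖) • γ.toFun u))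
      MeasureTheory.volume 0 1 :=
    (((h1.continuous.mul hv).smul γ.smooth.continuous).const_smul ε).intervalIntegrable _ _
  have hI := intervalIntegral.integral_eq_sub_of_hasDerivAt (fun u _ => hd u) (c1.sub c2)
  rw [intervalIntegral.integral_sub c1 c2, hper, sub_self, intervalIntegral.integral_smul, h3,
    smul_zero, sub_zero] at hI
  exact hI

theorem arcDeriv_add (c : ℝ → E3) {f g : ℝ → ℝ} (hf : ContDiff ℝ ∞ f) (hg : ContDiff ℝ ∞ g) :
    arcDeriv c (f + g) = arcDeriv c f + arcDeriv c g := by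
  funext u
  have := (hasDerivAt_of_smooth hf u).add (hasDerivAt_of_smooth hg u)
  simp only [arcDeriv, Pi.add_apply, this.deriv, smul_add]

theorem arcDeriv_smul (c : ℝ → E3) (a : ℝ) {f : ℝ → ℝ} (hf : ContDiff ℝ ∞ f) :
    arcDeriv c (a • f) = a • arcDeriv c f := by
  funext u
  have := (hasDerivAt_of_smooth hf u).const_smul a
  simp only [arcDeriv, Pi.smul_apply, this.deriv, smul_eq_mul]
  ring

end Helpers

/-- The evolute map `C_γ → C_γ̄`, `ρ ↦ ρ + ρ_ss`, where `s` is the arc length of the dual curve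
`γ̄`. -/
noncomputable def evolute (γ : SphericalCurve) : curveSpace γ →ₗ[ℝ] curveSpace γ.dual where
  toFun ρ := ⟨evoluteFun γ ρ, evoluteFun_mem γ ρ.2⟩
  map_add' ρ₁ ρ₂ := by
    ext u
    have s := fun ρ : curveSpace γ => contDiff_arcDeriv γ.dual.smooth γ.dual.immersed ρ.2.1
    simp only [evoluteFun, Submodule.coe_add, arcDeriv_add _ ρ₁.2.1 ρ₂.2.1,
      arcDeriv_add _ (s ρ₁) (s ρ₂), Pi.add_apply]
    ring
  map_smul' a ρ := by
    ext u
    have s := contDiff_arcDeriv γ.dual.smooth γ.dual.immersed ρ.2.1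
    simp only [evoluteFun, Submodule.coe_smul, arcDeriv_smul _ a ρ.2.1, arcDeriv_smul _ a s,
      Pi.smul_apply, smul_eq_mul, RingHom.id_apply]
    ring

end SpatialEvolute

/-!
Let `T = γ`, `N = γ_t`, `B = γ × γ_t` be the frame along `γ`, and let `s` be the arc length of the
dual curve `B`, so that `ds = |κ| dt` and the length of the dual curve is `|∫ κ dt|`.

*Bijectivity.* In terms of `z = ρ_s + i ρ` the equation `ρ + ρ_ss = σ` reads `z_s = i z + σ`. The
monodromy of this first order equation along the closed curve is rotation by the length of the dual
curve, so it differs from `1` exactly when `γ` is generic. In that case the homogeneous equation has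
no nonzero periodic solution (`eq_zero_of_hasDerivAt_of_monodromy_ne_one`), and variation of
constants gives a periodic solution for each periodic `σ`
(`exists_periodic_solution_of_monodromy_ne_one`). The closing condition for `ρ` on `γ` comes for
free: `ρ_s B - ρ B_s` is a periodic primitive of `σ B ds ∓ ρ γ dt`
(`integral_evoluteFun_smul_dual`).

*Openness.* The total geodesic curvature is the integral of `⟨γ'', γ × γ'⟩ / ‖γ'‖ ^ 2`, hence
continuous in the `C^∞` topology, and `2 π ℤ` is closed.

*Density.* The parallel curve `cos h γ + sin h B` has the unit tangent vector `N` of `γ` and the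
unit normal `cos h B - sin h γ`. Its total geodesic curvature is therefore
`cos h ∫ κ dt + sin h ∫ dt` (`totalGeodesicCurvature_parallelCurve`), whose derivative at `h = 0` is
the length of `γ`. Since this is not zero, a curve that is not generic becomes generic for all small
`h ≠ 0`, and the parallel curves converge to `γ` as `h → 0`.
-/

namespace SpatialEvolute

open Filter Topology MeasureTheory intervalIntegral

/-! ### Periodic solutions of a first order linear equation -/

theorem hasDerivAt_primitive {F : Type*} [NormedAddCommGroup F] [NormedSpace ℝ F]
    [CompleteSpace F] {f : ℝ → F} (hf : Continuous f) (u : ℝ) :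
    HasDerivAt (fun x => ∫ t in (0 : ℝ)..x, f t) (f u) u :=
  integral_hasDerivAt_right (hf.intervalIntegrable _ _)
    hf.stronglyMeasurable.stronglyMeasurableAtFilter hf.continuousAt

theorem contDiff_primitive {F : Type*} [NormedAddCommGroup F] [NormedSpace ℝ F]
    [CompleteSpace F] {f : ℝ → F} (hf : ContDiff ℝ ∞ f) :
    ContDiff ℝ ∞ (fun x => ∫ t in (0 : ℝ)..x, f t) := by
  rw [contDiff_infty_iff_deriv]
  refine ⟨fun u => (hasDerivAt_primitive hf.continuous u).differentiableAt, ?_⟩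
  rwa [funext fun u => (hasDerivAt_primitive hf.continuous u).deriv]

theorem hasDerivAt_exp_primitive {w : ℝ → ℝ} (hw : Continuous w) (a : ℂ) (u : ℝ) :
    HasDerivAt (fun x => Complex.exp (a * (∫ t in (0 : ℝ)..x, w t : ℝ)))
      (a * w u * Complex.exp (a * (∫ t in (0 : ℝ)..u, w t : ℝ))) u := by
  refine (((hasDerivAt_primitive hw u).ofReal_comp.const_mul a).cexp).congr_deriv ?_
  ring

theorem contDiff_exp_primitive {w : ℝ → ℝ} (hw : ContDiff ℝ ∞ w) (a : ℂ) :
    ContDiff ℝ ∞ (fun x => Complex.exp (a * (∫ t in (0 : ℝ)..x, w t : ℝ))) :=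
  Complex.contDiff_exp.comp
    (contDiff_const.mul (Complex.ofRealCLM.contDiff.comp (contDiff_primitive hw)))

/-- The homogeneous equation `z' = i w z` has no nonzero periodic solution, as long as its
monodromy `exp (i ∫ w)` is not `1`. -/
theorem eq_zero_of_hasDerivAt_of_monodromy_ne_one {w : ℝ → ℝ} (hw : Continuous w)
    (h1 : Complex.exp (Complex.I * (∫ t in (0 : ℝ)..1, w t : ℝ)) ≠ 1) {z : ℝ → ℂ}
    (hz : ∀ u, HasDerivAt z (Complex.I * w u * z u) u) (hper : z 1 = z 0) (u : ℝ) : z u = 0 := by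
  have hd : ∀ x, HasDerivAt
      (fun x => Complex.exp (-Complex.I * (∫ t in (0 : ℝ)..x, w t : ℝ)) * z x) 0 x := fun x =>
    ((hasDerivAt_exp_primitive hw (-Complex.I) x).mul (hz x)).congr_deriv (by ring)
  have hc := fun x => is_const_of_deriv_eq_zero (fun x => (hd x).differentiableAt)
    (fun x => (hd x).deriv) x 0
  simp only [integral_same, Complex.ofReal_zero, mul_zero, Complex.exp_zero, one_mul] at hc
  have hz0 : z 0 = 0 := by
    by_contra h0
    have h := hc 1
    rw [hper] at h
    have he := mul_right_cancel₀ h0 (h.trans (one_mul _).symm)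
    rw [neg_mul, Complex.exp_neg, inv_eq_one] at he
    exact h1 he
  have h := hc u
  rw [hz0] at h
  exact (mul_eq_zero.1 h).resolve_left (Complex.exp_ne_zero _)

/-- Variation of constants: the equation `z' = i w z + w σ` with periodic coefficients has a
periodic solution, as long as its monodromy `exp (i ∫ w)` is not `1`. -/
theorem exists_periodic_solution_of_monodromy_ne_one {w σ : ℝ → ℝ} (hw : ContDiff ℝ ∞ w)
    (hσ : ContDiff ℝ ∞ σ) (pw : Function.Periodic w 1) (pσ : Function.Periodic σ 1)
    (h1 : Complex.exp (Complex.I * (∫ t in (0 : ℝ)..1, w t : ℝ)) ≠ 1) :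
    ∃ z : ℝ → ℂ, ContDiff ℝ ∞ z ∧ Function.Periodic z 1 ∧
      ∀ u, HasDerivAt z (Complex.I * w u * z u + w u * σ u) u := by
  set L : ℝ := ∫ t in (0 : ℝ)..1, w t
  have hθ : ∀ x, ∫ t in (0 : ℝ)..(x + 1), w t = (∫ t in (0 : ℝ)..x, w t) + L := by
    intro x
    rw [pw.intervalIntegral_add_eq_add 0 x fun _ _ => hw.continuous.intervalIntegrable _ _,
      zero_add]
  let k : ℝ → ℂ := fun x =>
    Complex.exp (-Complex.I * (∫ t in (0 : ℝ)..x, w t : ℝ)) * (w x * σ x : ℝ)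
  have hk : ContDiff ℝ ∞ k :=
    (contDiff_exp_primitive hw _).mul (Complex.ofRealCLM.contDiff.comp (hw.mul hσ))
  have hi : ∀ a b, IntervalIntegrable k volume a b := fun a b =>
    hk.continuous.intervalIntegrable a b
  have hkper : ∀ x, k (x + 1) = Complex.exp (-(Complex.I * L)) * k x := by
    intro x
    simp only [k, hθ, pw x, pσ x]
    rw [Complex.ofReal_add, mul_add, Complex.exp_add]
    ring_nf
  set J : ℂ := ∫ t in (0 : ℝ)..1, k t with hJ
  have hI : ∀ x, ∫ t in (0 : ℝ)..(x + 1), k t =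
      J + Complex.exp (-(Complex.I * L)) * ∫ t in (0 : ℝ)..x, k t := by
    intro x
    rw [← integral_add_adjacent_intervals (hi 0 1) (hi 1 (x + 1)), ← hJ]
    congr 1
    have := integral_comp_add_right (a := 0) (b := x) k 1
    rw [zero_add] at this
    rw [← this, ← intervalIntegral.integral_const_mul]
    simp only [hkper]
  have hne : 1 - Complex.exp (Complex.I * L) ≠ 0 := sub_ne_zero.2 h1.symm
  -- the initial value for which `z 1 = z 0`
  set c : ℂ := Complex.exp (Complex.I * L) * J / (1 - Complex.exp (Complex.I * L))
  have hc : Complex.exp (Complex.I * L) * (c + J) = c := by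
    have : c * (1 - Complex.exp (Complex.I * L)) = Complex.exp (Complex.I * L) * J :=
      div_mul_cancel₀ _ hne
    linear_combination -this
  refine ⟨fun x => Complex.exp (Complex.I * (∫ t in (0 : ℝ)..x, w t : ℝ)) *
    (c + ∫ t in (0 : ℝ)..x, k t), (contDiff_exp_primitive hw _).mul
    (contDiff_const.add (contDiff_primitive hk)), fun x => ?_, fun u => ?_⟩
  · dsimp only
    have he : Complex.exp (Complex.I * L) * Complex.exp (-(Complex.I * L)) = 1 := by
      rw [← Complex.exp_add, add_neg_cancel, Complex.exp_zero]
    rw [hθ, hI, Complex.ofReal_add, mul_add Complex.I, Complex.exp_add]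
    linear_combination Complex.exp (Complex.I * (∫ t in (0 : ℝ)..x, w t : ℝ)) *
      (hc + (∫ t in (0 : ℝ)..x, k t) * he)
  · refine ((hasDerivAt_exp_primitive hw.continuous Complex.I u).mul
      ((hasDerivAt_primitive hk.continuous u).const_add c)).congr_deriv ?_
    have he : Complex.exp (Complex.I * (∫ t in (0 : ℝ)..u, w t : ℝ)) *
        Complex.exp (-Complex.I * (∫ t in (0 : ℝ)..u, w t : ℝ)) = 1 := by
      rw [← Complex.exp_add, neg_mul, add_neg_cancel, Complex.exp_zero]
    simp only [k, Complex.ofReal_mul]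
    linear_combination (w u * σ u : ℂ) * he

/-! ### Bijectivity of the evolute map -/

theorem dual_toFun (γ : SphericalCurve) : γ.dual.toFun = dualFun γ.toFun := rfl

theorem deriv_eq_mul_arcDeriv_dual (γ : SphericalCurve) (f : ℝ → ℝ) (u : ℝ) :
    deriv f u = ‖deriv γ.dual.toFun u‖ * arcDeriv γ.dual.toFun f u :=
  deriv_eq_speed_smul γ.dual u f

/-- The length of the dual curve is the absolute value of the total geodesic curvature, so
genericity says that rotation by this length is not the identity. -/
theorem SphericalCurve.Generic.monodromy_ne_one {γ : SphericalCurve} (hγ : γ.Generic) :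
    Complex.exp (Complex.I * (∫ t in (0 : ℝ)..1, ‖deriv γ.dual.toFun t‖ : ℝ)) ≠ 1 := by
  obtain ⟨ε, hε, h⟩ := exists_sign γ
  have hK : γ.totalGeodesicCurvature = ε * ∫ t in (0 : ℝ)..1, ‖deriv γ.dual.toFun t‖ := by
    rw [SphericalCurve.totalGeodesicCurvature, ← intervalIntegral.integral_const_mul]
    refine integral_congr fun u _ => ?_
    simp only [dual_toFun, norm_deriv_dualFun]
    rw [h u, abs_mul, abs_abs]
    have : |ε| = 1 := by
      rcases mul_self_eq_one_iff.1 hε with rfl | rfl <;> simp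
    rw [this]
    ring
  intro he
  obtain ⟨n, hn⟩ := Complex.exp_eq_one_iff.1 he
  have hn' : (∫ t in (0 : ℝ)..1, ‖deriv γ.dual.toFun t‖) = 2 * Real.pi * n := by
    have : ((∫ t in (0 : ℝ)..1, ‖deriv γ.dual.toFun t‖ : ℝ) : ℂ) = (2 * Real.pi * n : ℝ) := by
      refine mul_left_cancel₀ Complex.I_ne_zero (hn.trans ?_)
      push_cast
      ring
    exact_mod_cast this
  rcases mul_self_eq_one_iff.1 hε with rfl | rfl
  · exact hγ n (by rw [hK, hn', one_mul])
  · exact hγ (-n) (by rw [hK, hn']; push_cast; ring)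

/-- Integrating the derivative of `ρ_s B - ρ B_s`, where `B` is the dual curve, relates the
closing conditions of `ρ` on `γ` and of `ρ + ρ_ss` on the dual curve. -/
theorem integral_evoluteFun_smul_dual (γ : SphericalCurve) {ρ : ℝ → ℝ} (h1 : ContDiff ℝ ∞ ρ)
    (h2 : Function.Periodic ρ 1) {ε : ℝ} (hε : ε * ε = 1)
    (h : ∀ u, geodesicCurvature γ.toFun u = ε * |geodesicCurvature γ.toFun u|) :
    ∫ u in (0 : ℝ)..1, (evoluteFun γ ρ u * ‖deriv γ.dual.toFun u‖) • γ.dual.toFun u =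
      ε • ∫ u in (0 : ℝ)..1, (ρ u * ‖deriv γ.toFun u‖) • γ.toFun u := by
  have s1 := contDiff_arcDeriv γ.dual.smooth γ.dual.immersed h1
  have s2 := contDiff_arcDeriv γ.dual.smooth γ.dual.immersed s1
  have p1 := periodic_arcDeriv γ.dual.closed h2
  set F : ℝ → E3 := fun u => arcDeriv γ.dual.toFun ρ u • γ.dual.toFun u -
    ρ u • arcDeriv γ.dual.toFun γ.dual.toFun u with hF
  have hd : ∀ u, HasDerivAt F ((evoluteFun γ ρ u * ‖deriv γ.dual.toFun u‖) • γ.dual.toFun u -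
      ε • ((ρ u * ‖deriv γ.toFun u‖) • γ.toFun u)) u := by
    intro u
    have a1 := (hasDerivAt_of_smooth s1 u).smul (hasDerivAt_of_smooth γ.dual.smooth u)
    have a2 := (hasDerivAt_of_smooth h1 u).smul (hasDerivAt_arcDeriv_dualFun γ u h)
    refine (a1.sub a2).congr_deriv ?_
    have e0 : ε * geodesicCurvature γ.toFun u = |geodesicCurvature γ.toFun u| := by
      rw [h u, ← mul_assoc, hε, one_mul, ← h u]
    have hn : ‖deriv γ.dual.toFun u‖ =
        ‖deriv γ.toFun u‖ * (ε * geodesicCurvature γ.toFun u) := by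
      rw [e0]
      exact norm_deriv_dualFun γ u
    have d1 := deriv_eq_speed_smul γ.dual u (arcDeriv γ.dual.toFun ρ)
    have d2 := deriv_eq_speed_smul γ.dual u γ.dual.toFun
    have d3 := deriv_eq_speed_smul γ.dual u ρ
    rw [hn] at d1 d2 d3 ⊢
    rw [d1, d2, d3, dual_toFun]
    simp only [evoluteFun, smul_eq_mul, dual_toFun]
    module
  have hper : F 1 = F 0 := by
    have e1 := p1 0
    have e2 := h2 0
    have e3 := γ.dual.closed 0
    have e4 := periodic_arcDeriv γ.dual.closed γ.dual.closed 0
    rw [zero_add] at e1 e2 e3 e4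
    simp only [hF, e1, e2, e3, e4]
  have c1 : IntervalIntegrable (fun u => (evoluteFun γ ρ u * ‖deriv γ.dual.toFun u‖) •
      γ.dual.toFun u) volume 0 1 :=
    (((h1.add s2).continuous.mul (contDiff_deriv γ.dual.smooth).continuous.norm).smul
      γ.dual.smooth.continuous).intervalIntegrable _ _
  have c2 : IntervalIntegrable (fun u => ε • ((ρ u * ‖deriv γ.toFun u‖) • γ.toFun u))
      volume 0 1 :=
    (((h1.continuous.mul (contDiff_deriv γ.smooth).continuous.norm).smul
      γ.smooth.continuous).const_smul ε).intervalIntegrable _ _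
  have hI := integral_eq_sub_of_hasDerivAt (fun u _ => hd u) (c1.sub c2)
  rwa [intervalIntegral.integral_sub c1 c2, hper, sub_self, intervalIntegral.integral_smul,
    sub_eq_zero] at hI

/-- If `ρ + ρ_ss = 0`, then `z = ρ_s + i ρ` is a periodic solution of `z_s = i z`. -/
theorem evolute_injective {γ : SphericalCurve} (hγ : γ.Generic) :
    Function.Injective (evolute γ) := by
  rw [injective_iff_map_eq_zero]
  rintro ⟨ρ, h1, h2, h3⟩ h0
  have h0' : ∀ u, ρ u + arcDeriv γ.dual.toFun (arcDeriv γ.dual.toFun ρ) u = 0 := fun u =>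
    congrFun (congrArg Subtype.val h0) u
  have s1 := contDiff_arcDeriv γ.dual.smooth γ.dual.immersed h1
  have p1 := periodic_arcDeriv γ.dual.closed h2
  let z : ℝ → ℂ := fun u => arcDeriv γ.dual.toFun ρ u + Complex.I * ρ u
  have hz : ∀ u, HasDerivAt z (Complex.I * ‖deriv γ.dual.toFun u‖ * z u) u := by
    intro u
    have d1 := deriv_eq_mul_arcDeriv_dual γ ρ u
    have d2 := deriv_eq_mul_arcDeriv_dual γ (arcDeriv γ.dual.toFun ρ) u
    rw [eq_neg_of_add_eq_zero_right (h0' u)] at d2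
    refine ((hasDerivAt_of_smooth s1 u).ofReal_comp.add
      ((hasDerivAt_of_smooth h1 u).ofReal_comp.const_mul Complex.I)).congr_deriv ?_
    rw [d1, d2]
    simp only [z]
    push_cast
    linear_combination -(‖deriv γ.dual.toFun u‖ * ρ u : ℂ) * Complex.I_mul_I
  have hper : z 1 = z 0 := by
    have e1 := p1 0
    have e2 := h2 0
    rw [zero_add] at e1 e2
    simp only [z, e1, e2]
  have hz0 := eq_zero_of_hasDerivAt_of_monodromy_ne_one
    (contDiff_deriv γ.dual.smooth).continuous.norm hγ.monodromy_ne_one hz hper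
  ext u
  simpa [z] using congrArg Complex.im (hz0 u)

/-- A periodic solution of `z_s = i z + σ` has the form `z = ρ_s + i ρ` with `ρ + ρ_ss = σ`. -/
theorem evolute_surjective {γ : SphericalCurve} (hγ : γ.Generic) :
    Function.Surjective (evolute γ) := by
  rintro ⟨σ, h1, h2, h3⟩
  have hw : ContDiff ℝ ∞ fun u => ‖deriv γ.dual.toFun u‖ :=
    (contDiff_deriv γ.dual.smooth).norm ℝ γ.dual.immersed
  have pw : Function.Periodic (fun u => ‖deriv γ.dual.toFun u‖) 1 := fun u =>
    congrArg norm (periodic_deriv γ.dual.closed u)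
  obtain ⟨z, sz, pz, hz⟩ := exists_periodic_solution_of_monodromy_ne_one hw h1 pw h2
    hγ.monodromy_ne_one
  have hv := fun u => (speed_pos γ.dual u).ne'
  have hre : ∀ u, HasDerivAt (fun u => (z u).re)
      (‖deriv γ.dual.toFun u‖ * (σ u - (z u).im)) u := fun u =>
    (Complex.reCLM.hasFDerivAt.comp_hasDerivAt u (hz u)).congr_deriv (by simp; ring)
  have him : ∀ u, HasDerivAt (fun u => (z u).im) (‖deriv γ.dual.toFun u‖ * (z u).re) u := fun u =>
    (Complex.imCLM.hasFDerivAt.comp_hasDerivAt u (hz u)).congr_deriv (by simp)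
  have e1 : arcDeriv γ.dual.toFun (fun u => (z u).im) = fun u => (z u).re := by
    funext u
    rw [arcDeriv, (him u).deriv, smul_eq_mul, inv_mul_cancel_left₀ (hv u)]
  have e2 : evoluteFun γ (fun u => (z u).im) = σ := by
    funext u
    rw [evoluteFun, e1, arcDeriv, (hre u).deriv, smul_eq_mul, inv_mul_cancel_left₀ (hv u)]
    ring
  have sρ : ContDiff ℝ ∞ fun u => (z u).im := Complex.imCLM.contDiff.comp sz
  have pρ : Function.Periodic (fun u => (z u).im) 1 := fun u => congrArg Complex.im (pz u)
  obtain ⟨ε, hε, h⟩ := exists_sign γ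
  have hI := integral_evoluteFun_smul_dual γ sρ pρ hε h
  rw [e2, h3] at hI
  have hε0 : ε ≠ 0 := left_ne_zero_of_mul (hε.trans_ne one_ne_zero)
  exact ⟨⟨_, sρ, pρ, (smul_eq_zero.1 hI.symm).resolve_left hε0⟩, Subtype.ext e2⟩

/-! ### Genericity is an open condition -/

theorem tendsto_iff_tendstoUniformly_iteratedDeriv {ι : Type*} {l : Filter ι}
    {c : ι → SphericalCurve} {γ : SphericalCurve} :
    Tendsto c l (𝓝 γ) ↔ ∀ k, TendstoUniformly (fun i => iteratedDeriv k (c i).toFun)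
      (iteratedDeriv k γ.toFun) l := by
  simp only [nhds_iInf, nhds_induced, tendsto_iInf, tendsto_comap_iff,
    UniformFun.tendsto_iff_tendstoUniformly]
  rfl

theorem continuous_uncurry_iteratedDeriv (k : ℕ) :
    Continuous fun p : SphericalCurve × ℝ => iteratedDeriv k p.1.toFun p.2 := by
  rw [continuous_iff_continuousAt]
  rintro ⟨γ, u⟩
  have hc : Continuous (iteratedDeriv k γ.toFun) :=
    γ.smooth.continuous_iteratedDeriv k (by exact_mod_cast le_top)
  have h := tendsto_iff_tendstoUniformly_iteratedDeriv.1
    (continuous_fst.tendsto (γ, u) : Tendsto Prod.fst (𝓝 (γ, u)) (𝓝 γ)) k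
  exact h.tendsto_comp hc.continuousAt continuous_snd.continuousAt

/-- The integrand of the total geodesic curvature as a function of the first two derivatives of
the curve. -/
theorem geodesicCurvature_mul_speed (γ : SphericalCurve) (u : ℝ) :
    geodesicCurvature γ.toFun u * ‖deriv γ.toFun u‖ =
      inner ℝ (iteratedDeriv 2 γ.toFun u) (cross (γ.toFun u) (iteratedDeriv 1 γ.toFun u)) /
        ‖iteratedDeriv 1 γ.toFun u‖ ^ 2 := by
  have hv := (speed_pos γ u).ne'
  have hs : ContDiff ℝ ∞ fun u => ‖deriv γ.toFun u‖ :=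
    (contDiff_deriv γ.smooth).norm ℝ γ.immersed
  have h1 := (hasDerivAt_of_smooth hs u).smul (hasDerivAt_tangent γ u)
  have e1 : (fun u => ‖deriv γ.toFun u‖) • arcDeriv γ.toFun γ.toFun = deriv γ.toFun :=
    funext fun u => (deriv_eq_speed_smul γ u γ.toFun).symm
  rw [e1] at h1
  have e2 : cross (γ.toFun u) (deriv γ.toFun u) = ‖deriv γ.toFun u‖ • dualFun γ.toFun u := by
    conv_lhs => rw [deriv_eq_speed_smul γ u γ.toFun, cross_smul, ← dualFun]
  have i1 : inner ℝ (γ.toFun u) (dualFun γ.toFun u) = (0 : ℝ) := inner_cross_left _ _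
  have i2 : inner ℝ (arcDeriv γ.toFun γ.toFun u) (dualFun γ.toFun u) = (0 : ℝ) :=
    inner_cross_right _ _
  have i3 : inner ℝ (dualFun γ.toFun u) (dualFun γ.toFun u) = (1 : ℝ) := inner_self_one γ.dual u
  rw [iteratedDeriv_succ, iteratedDeriv_one, h1.deriv, e2]
  simp only [inner_smul_left, inner_smul_right, inner_add_left, inner_neg_left, conj_trivial, i1,
    i2, i3]
  field_simp
  ring

theorem continuous_geodesicCurvature (γ : SphericalCurve) :
    Continuous (geodesicCurvature γ.toFun) :=
  ((contDiff_arcDeriv γ.smooth γ.immersed (contDiff_tangent γ)).inner ℝ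
    (contDiff_dualFun γ)).continuous

theorem continuous_totalGeodesicCurvature :
    Continuous SphericalCurve.totalGeodesicCurvature := by
  have h0 := continuous_uncurry_iteratedDeriv 0
  have h1 := continuous_uncurry_iteratedDeriv 1
  have h2 := continuous_uncurry_iteratedDeriv 2
  simp only [iteratedDeriv_zero] at h0
  have hcross : Continuous fun p : SphericalCurve × ℝ =>
      cross (p.1.toFun p.2) (iteratedDeriv 1 p.1.toFun p.2) := by
    have hc : Continuous fun q : E3 × E3 => cross q.1 q.2 := by
      simp only [cross, cross_apply]
      fun_prop
    exact hc.comp (h0.prodMk h1)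
  have hg : Continuous fun p : SphericalCurve × ℝ =>
      geodesicCurvature p.1.toFun p.2 * ‖deriv p.1.toFun p.2‖ := by
    simp only [geodesicCurvature_mul_speed]
    refine (h2.inner hcross).div (h1.norm.pow 2) fun p => ?_
    rw [iteratedDeriv_one]
    exact pow_ne_zero 2 (speed_pos p.1 p.2).ne'
  -- the integral is continuous for the topology of compact convergence on the integrands
  have hint : Continuous fun f : C(ℝ, ℝ) => ∫ u in (0 : ℝ)..1, f u := by
    rw [continuous_iff_continuousAt]
    intro f
    exact TendstoUniformlyOn.tendsto_intervalIntegral_of_continuousOn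
      (Eventually.of_forall fun g => g.continuous.continuousOn)
      (ContinuousMap.tendsto_iff_forall_isCompact_tendstoUniformlyOn.1 tendsto_id _ isCompact_uIcc)
  let G : SphericalCurve → C(ℝ, ℝ) := fun γ =>
    ⟨fun u => geodesicCurvature γ.toFun u * ‖deriv γ.toFun u‖, (continuous_geodesicCurvature γ).mul
      (contDiff_deriv γ.smooth).continuous.norm⟩
  exact hint.comp (ContinuousMap.continuous_of_continuous_uncurry G hg)

theorem isOpen_generic : IsOpen {γ : SphericalCurve | γ.Generic} := by
  have hcl : IsClosed (Set.range fun n : ℤ => 2 * Real.pi * (n : ℝ)) := by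
    have := (AddSubgroup.isClosed_of_discrete (H := AddSubgroup.zmultiples (2 * Real.pi)))
    convert this using 1
    ext x
    simp [AddSubgroup.mem_zmultiples_iff, mul_comm]
  convert hcl.isOpen_compl.preimage continuous_totalGeodesicCurvature using 1
  ext γ
  simp [SphericalCurve.Generic, eq_comm]

/-! ### Parallel curves and density -/

/-- The parallel curve at spherical distance `h`, in the direction of the unit normal. -/
noncomputable def parallelFun (γ : SphericalCurve) (h u : ℝ) : E3 :=
  Real.cos h • γ.toFun u + Real.sin h • dualFun γ.toFun u

/-- The conditions on `h` that make the parallel curve immersed, with the orientation of `γ`, and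
locally convex. -/
def IsAdmissible (γ : SphericalCurve) (h : ℝ) : Prop :=
  ∀ u, 0 < Real.cos h - Real.sin h * geodesicCurvature γ.toFun u ∧
    Real.sin h + Real.cos h * geodesicCurvature γ.toFun u ≠ 0

section Parallel

variable (γ : SphericalCurve) (h : ℝ)

theorem contDiff_parallelFun : ContDiff ℝ ∞ (parallelFun γ h) :=
  (γ.smooth.const_smul (Real.cos h)).add ((contDiff_dualFun γ).const_smul (Real.sin h))

theorem deriv_parallelFun (u : ℝ) : deriv (parallelFun γ h) u =
    (‖deriv γ.toFun u‖ * (Real.cos h - Real.sin h * geodesicCurvature γ.toFun u)) •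
      arcDeriv γ.toFun γ.toFun u := by
  refine (((hasDerivAt_of_smooth γ.smooth u).const_smul (Real.cos h)).add
    ((hasDerivAt_dualFun γ u).const_smul (Real.sin h))).deriv.trans ?_
  have e : deriv γ.toFun u = _ := deriv_eq_speed_smul γ u γ.toFun
  generalize ‖deriv γ.toFun u‖ = v at e ⊢
  rw [e]
  module

variable {γ h}

theorem norm_deriv_parallelFun (ha : IsAdmissible γ h) (u : ℝ) : ‖deriv (parallelFun γ h) u‖ =
    ‖deriv γ.toFun u‖ * (Real.cos h - Real.sin h * geodesicCurvature γ.toFun u) := by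
  rw [deriv_parallelFun, norm_smul, norm_tangent, mul_one, Real.norm_of_nonneg]
  exact (mul_pos (speed_pos γ u) (ha u).1).le

/-- Parallel curves have the same unit tangent vectors. -/
theorem arcDeriv_parallelFun (ha : IsAdmissible γ h) :
    arcDeriv (parallelFun γ h) (parallelFun γ h) = arcDeriv γ.toFun γ.toFun := by
  funext u
  have h0 := (mul_pos (speed_pos γ u) (ha u).1).ne'
  rw [arcDeriv, norm_deriv_parallelFun ha, deriv_parallelFun, smul_smul, inv_mul_cancel₀ h0,
    one_smul]

theorem dualFun_parallelFun (ha : IsAdmissible γ h) (u : ℝ) : dualFun (parallelFun γ h) u =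
    Real.cos h • dualFun γ.toFun u - Real.sin h • γ.toFun u := by
  have hB : cross (dualFun γ.toFun u) (arcDeriv γ.toFun γ.toFun u) = -γ.toFun u :=
    cross_cross_right (inner_tangent_self γ u) (inner_tangent γ u)
  have hadd : ∀ x y z : E3, cross (x + y) z = cross x z + cross y z := fun x y z => by
    simp [cross]
  rw [dualFun, arcDeriv_parallelFun ha, parallelFun, hadd, smul_cross, smul_cross, hB, ← dualFun]
  module

theorem geodesicCurvature_parallelFun_mul_speed (ha : IsAdmissible γ h) (u : ℝ) :
    geodesicCurvature (parallelFun γ h) u * ‖deriv (parallelFun γ h) u‖ =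
      ‖deriv γ.toFun u‖ * (Real.sin h + Real.cos h * geodesicCurvature γ.toFun u) := by
  have h0 : ‖deriv (parallelFun γ h) u‖ ≠ 0 := by
    rw [norm_deriv_parallelFun ha]
    exact (mul_pos (speed_pos γ u) (ha u).1).ne'
  have i1 : inner ℝ (γ.toFun u) (dualFun γ.toFun u) = (0 : ℝ) := inner_cross_left _ _
  have i2 : inner ℝ (dualFun γ.toFun u) (γ.toFun u) = (0 : ℝ) := by rw [real_inner_comm, i1]
  have i3 : inner ℝ (dualFun γ.toFun u) (dualFun γ.toFun u) = (1 : ℝ) := inner_self_one γ.dual u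
  rw [geodesicCurvature, arcDeriv_parallelFun ha, dualFun_parallelFun ha, arcDeriv,
    (hasDerivAt_tangent γ u).deriv]
  simp only [inner_smul_left, inner_smul_right, inner_add_left, inner_neg_left, inner_sub_right,
    conj_trivial, i1, i2, i3, inner_self_one γ u]
  field_simp
  ring

/-- The parallel curve of `γ` as a spherical curve. -/
noncomputable def parallelCurve (ha : IsAdmissible γ h) : SphericalCurve where
  toFun := parallelFun γ h
  smooth := contDiff_parallelFun γ h
  closed := fun u => by
    have := γ.dual.closed u
    simp only [SphericalCurve.dual] at this
    simp only [parallelFun, γ.closed u, this]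
  norm_eq_one := fun u => by
    have i1 : inner ℝ (γ.toFun u) (dualFun γ.toFun u) = (0 : ℝ) := inner_cross_left _ _
    have i2 : inner ℝ (dualFun γ.toFun u) (γ.toFun u) = (0 : ℝ) := by rw [real_inner_comm, i1]
    have i3 : inner ℝ (dualFun γ.toFun u) (dualFun γ.toFun u) = (1 : ℝ) := inner_self_one γ.dual u
    rw [← pow_eq_one_iff_of_nonneg (norm_nonneg _) two_ne_zero, ← real_inner_self_eq_norm_sq]
    simp only [parallelFun, inner_smul_left, inner_smul_right, inner_add_left, inner_add_right,
      conj_trivial, i1, i2, i3, inner_self_one γ u]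
    linear_combination Real.cos_sq_add_sin_sq h
  immersed := fun u => by
    rw [← norm_ne_zero_iff, norm_deriv_parallelFun ha]
    exact (mul_pos (speed_pos γ u) (ha u).1).ne'
  locallyConvex := fun u => by
    refine left_ne_zero_of_mul (b := ‖deriv (parallelFun γ h) u‖) ?_
    rw [geodesicCurvature_parallelFun_mul_speed ha]
    exact mul_ne_zero (speed_pos γ u).ne' (ha u).2

theorem totalGeodesicCurvature_parallelCurve (ha : IsAdmissible γ h) :
    (parallelCurve ha).totalGeodesicCurvature = Real.cos h * γ.totalGeodesicCurvature +
      Real.sin h * ∫ u in (0 : ℝ)..1, ‖deriv γ.toFun u‖ := by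
  have hv : Continuous fun u => ‖deriv γ.toFun u‖ := (contDiff_deriv γ.smooth).continuous.norm
  have hκ := continuous_geodesicCurvature γ
  rw [SphericalCurve.totalGeodesicCurvature, SphericalCurve.totalGeodesicCurvature,
    ← intervalIntegral.integral_const_mul, ← intervalIntegral.integral_const_mul,
    ← intervalIntegral.integral_add]
  · refine integral_congr fun u _ => ?_
    refine (geodesicCurvature_parallelFun_mul_speed ha u).trans ?_
    ring
  · exact (continuous_const.mul (hκ.mul hv)).intervalIntegrable _ _
  · exact (continuous_const.mul hv).intervalIntegrable _ _

end Parallel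

theorem eventually_isAdmissible (γ : SphericalCurve) : ∀ᶠ h in 𝓝 (0 : ℝ), IsAdmissible γ h := by
  have hκ := continuous_geodesicCurvature γ
  have hper : Function.Periodic (geodesicCurvature γ.toFun) 1 := fun u => by
    have h1 := periodic_arcDeriv γ.closed (periodic_arcDeriv γ.closed γ.closed) u
    have h2 := γ.dual.closed u
    simp only [SphericalCurve.dual] at h2
    rw [geodesicCurvature, geodesicCurvature, h1, h2]
  have hK : ∀ᶠ h in 𝓝 (0 : ℝ), ∀ u ∈ Set.Icc (0 : ℝ) 1,
      0 < Real.cos h - Real.sin h * geodesicCurvature γ.toFun u ∧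
        Real.sin h + Real.cos h * geodesicCurvature γ.toFun u ≠ 0 := by
    refine isCompact_Icc.eventually_forall_of_forall_eventually fun u _ => ?_
    have c1 : Continuous fun p : ℝ × ℝ =>
        Real.cos p.1 - Real.sin p.1 * geodesicCurvature γ.toFun p.2 := by fun_prop
    have c2 : Continuous fun p : ℝ × ℝ =>
        Real.sin p.1 + Real.cos p.1 * geodesicCurvature γ.toFun p.2 := by fun_prop
    refine (c1.continuousAt.eventually (lt_mem_nhds ?_)).and (c2.continuousAt.eventually_ne ?_)
    · simp
    · simpa using γ.locallyConvex u
  filter_upwards [hK] with h hh u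
  obtain ⟨y, hy, e⟩ := hper.exists_mem_Ico₀ one_pos u
  rw [e]
  exact hh y ⟨hy.1, hy.2.le⟩

theorem tendstoUniformly_iteratedDeriv_parallelFun (γ : SphericalCurve) (k : ℕ) :
    TendstoUniformly (fun h => iteratedDeriv k (parallelFun γ h)) (iteratedDeriv k γ.toFun)
      (𝓝 0) := by
  have hle : ((k : ℕ∞) : WithTop ℕ∞) ≤ ∞ := by exact_mod_cast le_top
  have hform : ∀ h u, iteratedDeriv k (parallelFun γ h) u =
      Real.cos h • iteratedDeriv k γ.toFun u + Real.sin h • iteratedDeriv k γ.dual.toFun u := by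
    intro h u
    have s1 : ContDiffAt ℝ k γ.toFun u := (γ.smooth.of_le hle).contDiffAt
    have s2 : ContDiffAt ℝ k γ.dual.toFun u := (γ.dual.smooth.of_le hle).contDiffAt
    refine (iteratedDeriv_fun_add (s1.const_smul (Real.cos h))
      (s2.const_smul (Real.sin h))).trans ?_
    rw [iteratedDeriv_fun_const_smul s1, iteratedDeriv_fun_const_smul s2]
  have hbd : ∀ δ : SphericalCurve, ∃ C, ∀ u, ‖iteratedDeriv k δ.toFun u‖ ≤ C := by
    intro δ
    have hp : ∀ k, Function.Periodic (iteratedDeriv k δ.toFun) 1 := by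
      intro k
      induction k with
      | zero => simpa using δ.closed
      | succ k ih => rw [iteratedDeriv_succ]; exact periodic_deriv ih
    obtain ⟨C, hC⟩ := ((hp k).isBounded_of_continuous one_ne_zero
      (δ.smooth.continuous_iteratedDeriv k hle)).exists_norm_le
    exact ⟨C, fun u => hC _ ⟨u, rfl⟩⟩
  obtain ⟨C, hC⟩ := hbd γ
  obtain ⟨D, hD⟩ := hbd γ.dual
  have hlim : Tendsto (fun h => |1 - Real.cos h| * C + |Real.sin h| * D) (𝓝 0) (𝓝 0) := by
    have : Continuous fun h => |1 - Real.cos h| * C + |Real.sin h| * D := by fun_prop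
    simpa using this.tendsto 0
  rw [Metric.tendstoUniformly_iff]
  intro r hr
  filter_upwards [hlim.eventually (gt_mem_nhds hr)] with h hh u
  refine lt_of_le_of_lt ?_ hh
  rw [dist_eq_norm, hform]
  have e : iteratedDeriv k γ.toFun u - (Real.cos h • iteratedDeriv k γ.toFun u +
      Real.sin h • iteratedDeriv k γ.dual.toFun u) = (1 - Real.cos h) • iteratedDeriv k γ.toFun u -
      Real.sin h • iteratedDeriv k γ.dual.toFun u := by module
  rw [e]
  refine (norm_sub_le _ _).trans (add_le_add ?_ ?_)
  · rw [norm_smul, Real.norm_eq_abs]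
    exact mul_le_mul_of_nonneg_left (hC u) (abs_nonneg _)
  · rw [norm_smul, Real.norm_eq_abs]
    exact mul_le_mul_of_nonneg_left (hD u) (abs_nonneg _)

/-- The total geodesic curvature of the parallel curves has at `h = 0` the derivative
`∫ ‖γ'‖ > 0`, so that it is not in `2 π ℤ` for small `h ≠ 0`. -/
theorem dense_generic : Dense {γ : SphericalCurve | γ.Generic} := by
  classical
  intro γ
  by_cases hγ : γ.Generic
  · exact subset_closure hγ
  obtain ⟨n, hn⟩ : ∃ n : ℤ, γ.totalGeodesicCurvature = 2 * Real.pi * n := by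
    simpa [SphericalCurve.Generic] using hγ
  set ℓ : ℝ := ∫ u in (0 : ℝ)..1, ‖deriv γ.toFun u‖ with hℓ
  have hℓ0 : 0 < ℓ := intervalIntegral_pos_of_pos
    ((contDiff_deriv γ.smooth).continuous.norm.intervalIntegrable _ _) (speed_pos γ) one_pos
  have had := eventually_isAdmissible γ
  let c : ℝ → SphericalCurve := fun h =>
    if ha : IsAdmissible γ h then parallelCurve ha else γ
  have hc : Tendsto c (𝓝 0) (𝓝 γ) := by
    rw [tendsto_iff_tendstoUniformly_iteratedDeriv]
    intro k V hV
    filter_upwards [had, tendstoUniformly_iteratedDeriv_parallelFun γ k V hV] with h ha hh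
    simpa only [c, dif_pos ha, parallelCurve] using hh
  have hd : HasDerivAt (fun h => Real.cos h * γ.totalGeodesicCurvature + Real.sin h * ℓ) ℓ 0 := by
    refine (((Real.hasDerivAt_cos 0).mul_const _).add
      ((Real.hasDerivAt_sin 0).mul_const ℓ)).congr_deriv ?_
    simp
  have hne := hd.eventually_ne (c := γ.totalGeodesicCurvature) hℓ0.ne'
  have hnear : ∀ᶠ h in 𝓝 (0 : ℝ), |Real.cos h * γ.totalGeodesicCurvature + Real.sin h * ℓ -
      γ.totalGeodesicCurvature| < 2 * Real.pi := by
    have := hd.continuousAt.eventually (Metric.ball_mem_nhds _ Real.two_pi_pos)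
    simpa [Real.dist_eq] using this
  refine mem_closure_of_tendsto (hc.mono_left nhdsWithin_le_nhds) (b := 𝓝[≠] (0 : ℝ)) ?_
  filter_upwards [hne, nhdsWithin_le_nhds hnear, nhdsWithin_le_nhds had] with h h1 h2 ha m hm
  simp only [c, dif_pos ha] at hm
  rw [totalGeodesicCurvature_parallelCurve, ← hℓ] at hm
  rw [hm, hn] at h1 h2
  -- two elements of `2 π ℤ` at a distance less than `2 π` coincide
  rw [← mul_sub, abs_mul, abs_of_pos Real.two_pi_pos, mul_lt_iff_lt_one_right Real.two_pi_pos] at h2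
  have h3 : |m - n| < 1 := by exact_mod_cast h2
  rw [Int.abs_lt_one_iff, sub_eq_zero] at h3
  exact h1 (by rw [h3])

end SpatialEvolute

/-- Generic spherical curves form an open dense subset of the space of spherical curves with the
`C^∞` topology, and for each of them the linear evolute map is a bijection. -/
theorem proposition3p8 :
    IsOpen {γ : SpatialEvolute.SphericalCurve | γ.Generic} ∧
      Dense {γ : SpatialEvolute.SphericalCurve | γ.Generic} ∧
      ∀ γ : SpatialEvolute.SphericalCurve, γ.Generic →
        Function.Bijective (SpatialEvolute.evolute γ) := by
  exact ⟨SpatialEvolute.isOpen_generic, SpatialEvolute.dense_generic, fun _ hγ =>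
    ⟨SpatialEvolute.evolute_injective hγ, SpatialEvolute.evolute_surjective hγ⟩⟩
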